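/- Fix a set of atoms, and let formulas be built from atoms, $\bot$, $\top$ by $\wedge,\vee,\to,\neg$. For a set $X$ of atoms write $\langle X\rangle\models A$ if $A$ is true in the classical valuation making exactly the atoms in $X$ true. The reduct $A^X$ leaves atoms, $\bot$ and $\top$ unchanged, commutes with $\wedge,\vee,\to$, and $(\neg A)^X$ is $\bot$ if $\langle X\rangle\models A$ and $\top$ otherwise. A program is a (possibly infinite) set of formulas; $\Pi^X=\{A^X\mid A\in\Pi\}$. A set $X$ of atoms is an answer set of $\Pi$ if for all $Y\subseteq X$: $\langle Y\rangle\models\Pi^X\Leftrightarrow Y=X$. Programs $\Pi_1,\Pi_2$ are strongly equivalent in a language $L$ if for every program $\Pi\subseteq L$ the programs $\Pi_1\cup\Pi$ and $\Pi_2\cup\Pi$ have the same answer sets. An intermediate logic $\mathbf{\Lambda}$ is obtained from intuitionistic propositional logic by adding a set of classically valid formulas as axiom schemes; $\mathbf{KC}$ is obtained by adding $\neg A\vee\neg\neg A$. Write $\Pi_1\equiv_{\mathbf\Lambda}\Pi_2$ if every formula of each program is derivable in $\mathbf\Lambda$ from the other. $\mathbf\Lambda_1$ is weaker than (or as strong as)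 $\mathbf\Lambda_2$ if every theorem of $\mathbf\Lambda_1$ is a theorem of $\mathbf\Lambda_2$. Let $[\neg]$ be the set of formulas built from atoms using negation only, and let $L=\{A\to B\mid A,B\in[\neg]\}$. Then: 1. For all $\Pi_1,\Pi_2\subseteq L$: $\Pi_1$ and $\Pi_2$ are strongly equivalent in $L$ if and only if $\Pi_1\equiv_{\mathbf{KC}}\Pi_2$. 2. If there are at least two atoms, $\mathbf{KC}$ is the weakest intermediate logic $\mathbf\Lambda$ such that for all $\Pi_1,\Pi_2\subseteq L$: $\Pi_1,\Pi_2$ are strongly equivalent in $L$ if and only if $\Pi_1\equiv_{\mathbf\Lambda}\Pi_2$. It is also the weakest intermediate logic $\mathbf\Lambda$ such that strong equivalence in $L$ of programs $\Pi_1,\Pi_2\subseteq L$ implies $\Pi_1\equiv_{\mathbf\Lambda}\Pi_2$. 3. For all atoms $p,q$ the programs $\{q\}$ and $\{\neg p\to q,\ \neg\neg p\to q\}$ are strongly equivalent in $L$; and if $p\neq q$, an intermediate logic $\mathbf\Lambda$ satisfies $\{q\}\equiv_{\mathbf\Lambda}\{\neg p\to q,\ \neg\neg p\to q\}$ if and only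 if every theorem of $\mathbf{KC}$ is a theorem of $\mathbf\Lambda$. All three statements also hold with $L$ replaced by $\{A\to B\mid A,B\in[\neg]\}\cup[\neg]$, i.e. when facts such as $q$ are also allowed as rules. -/

import Mathlib

/-- Propositional formulas over a type `α` of atoms. Negation is a primitive connective,
because the reduct of a program treats `¬A` differently from `A → ⊥`. -/
inductive PropForm (α : Type*) : Type _
  | atom : α → PropForm α
  | bot : PropForm α
  | top : PropForm α
  | and : PropForm α → PropForm α → PropForm α
  | or : PropForm α → PropForm α → PropForm α
  | imp : PropForm α → PropForm α → PropForm α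
  | neg : PropForm α → PropForm α

namespace PropForm

/-- Simultaneous substitution of formulas for atoms. -/
def subst {α : Type*} (σ : α → PropForm α) : PropForm α → PropForm α
  | atom p => σ p
  | bot => bot
  | top => top
  | and A B => and (subst σ A) (subst σ B)
  | or A B => or (subst σ A) (subst σ B)
  | imp A B => imp (subst σ A) (subst σ B)
  | neg A => neg (subst σ A)

/-- `⟨X⟩ ⊨ A`: truth in the classical valuation that makes exactly the atoms in `X` true. -/
def Sat {α : Type*} (X : Set α) : PropForm α → Prop
  | atom p => p ∈ X
  | bot => False
  | top => True
  | and A B => Sat X A ∧ Sat X B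
  | or A B => Sat X A ∨ Sat X B
  | imp A B => Sat X A → Sat X B
  | neg A => ¬ Sat X A

open scoped Classical in
/-- The reduct `A^X`: every outermost negation `¬B` is replaced by `⊥` if `⟨X⟩ ⊨ B`, and by `⊤`
otherwise. -/
noncomputable def reduct {α : Type*} (X : Set α) : PropForm α → PropForm α
  | atom p => atom p
  | bot => bot
  | top => top
  | and A B => and (reduct X A) (reduct X B)
  | or A B => or (reduct X A) (reduct X B)
  | imp A B => imp (reduct X A) (reduct X B)
  | neg A => if Sat X A then bot else top

/-- Membership in the fragment `[¬]`: formulas built from atoms by negation only. -/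
inductive InNeg {α : Type*} : PropForm α → Prop
  | atom (p : α) : InNeg (atom p)
  | neg {A : PropForm α} : InNeg A → InNeg (neg A)

end PropForm

/-- The fragment `[¬]` as a set of formulas. -/
def negFragment (α : Type*) : Set (PropForm α) :=
  {A | PropForm.InNeg A}

/-- The language `{A → B | A, B ∈ [¬]}`. -/
def negRules (α : Type*) : Set (PropForm α) :=
  {R | ∃ A ∈ negFragment α, ∃ B ∈ negFragment α, R = PropForm.imp A B}

/-- `X` is an answer set of the program `P`: for all `Y ⊆ X`, `⟨Y⟩ ⊨ P^X` iff `Y = X`. -/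
def IsAnswerSet {α : Type*} (P : Set (PropForm α)) (X : Set α) : Prop :=
  ∀ Y : Set α, Y ⊆ X → ((∀ R ∈ P, PropForm.Sat Y (PropForm.reduct X R)) ↔ Y = X)

/-- Strong equivalence in the language `L`: for every program `P` in `L`,
`P₁ ∪ P` and `P₂ ∪ P` have the same answer sets. -/
def StronglyEquivalent {α : Type*} (L P₁ P₂ : Set (PropForm α)) : Prop :=
  ∀ P : Set (PropForm α), P ⊆ L →
    ∀ X : Set α, IsAnswerSet (P₁ ∪ P) X ↔ IsAnswerSet (P₂ ∪ P) X

open PropForm in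
/-- Derivability of a formula from the hypotheses `T` in the Hilbert calculus for intuitionistic
propositional logic extended by all substitution instances of the formulas in `Ax`. -/
inductive Derives {α : Type*} (Ax T : Set (PropForm α)) : PropForm α → Prop
  | hyp {A : PropForm α} : A ∈ T → Derives Ax T A
  | scheme {A : PropForm α} (σ : α → PropForm α) : A ∈ Ax → Derives Ax T (subst σ A)
  | mp {A B : PropForm α} : Derives Ax T (imp A B) → Derives Ax T A → Derives Ax T B
  | axK (A B : PropForm α) : Derives Ax T (imp A (imp B A))
  | axS (A B C : PropForm α) :
      Derives Ax T (imp (imp A (imp B C)) (imp (imp A B) (imp A C)))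
  | andIntro (A B : PropForm α) : Derives Ax T (imp A (imp B (and A B)))
  | andLeft (A B : PropForm α) : Derives Ax T (imp (and A B) A)
  | andRight (A B : PropForm α) : Derives Ax T (imp (and A B) B)
  | orLeft (A B : PropForm α) : Derives Ax T (imp A (or A B))
  | orRight (A B : PropForm α) : Derives Ax T (imp B (or A B))
  | orElim (A B C : PropForm α) :
      Derives Ax T (imp (imp A C) (imp (imp B C) (imp (or A B) C)))
  | botElim (A : PropForm α) : Derives Ax T (imp bot A)
  | topIntro : Derives Ax T top
  | negIntro (A : PropForm α) : Derives Ax T (imp (imp A bot) (neg A))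
  | negElim (A : PropForm α) : Derives Ax T (imp (neg A) (imp A bot))

/-- An intermediate logic, presented by a set of classically valid formulas that are added to
intuitionistic propositional logic as schemes. -/
structure IntermediateLogic (α : Type*) where
  schemes : Set (PropForm α)
  valid : ∀ A ∈ schemes, ∀ X : Set α, PropForm.Sat X A

namespace IntermediateLogic

/-- `T ⊢_Λ A`. -/
def Proves {α : Type*} (Λ : IntermediateLogic α) (T : Set (PropForm α)) (A : PropForm α) : Prop :=
  Derives Λ.schemes T A

/-- `P₁ ≡_Λ P₂`: each formula of either set is derivable in `Λ` from the other set. -/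
def Equivalent {α : Type*} (Λ : IntermediateLogic α) (P₁ P₂ : Set (PropForm α)) : Prop :=
  (∀ A ∈ P₂, Λ.Proves P₁ A) ∧ (∀ A ∈ P₁, Λ.Proves P₂ A)

/-- `Λ₁ ≤ Λ₂`: `Λ₁` is at most as strong as `Λ₂`, i.e. every theorem of `Λ₁` is one of `Λ₂`. -/
instance instPreorder {α : Type*} : Preorder (IntermediateLogic α) where
  le Λ₁ Λ₂ := ∀ A : PropForm α, Λ₁.Proves ∅ A → Λ₂.Proves ∅ A
  le_refl _ _ h := h
  le_trans _ _ _ h₁ h₂ A h := h₂ A (h₁ A h)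

/-- The logic **KC**, with the axiom scheme `¬A ∨ ¬¬A`. -/
def KC (α : Type*) : IntermediateLogic α where
  schemes := {F | ∃ A : PropForm α, F = (A.neg).or (A.neg.neg)}
  valid := by
    rintro _ ⟨A, rfl⟩ X
    exact em (¬ PropForm.Sat X A)

end IntermediateLogic

/-! Both sides of the equivalence amount to having the same here-and-there models `Y ⊆ X`. For a
rule, truth in such a model means that `Y` satisfies the reduct and `X` the rule, so answer sets are
the total models `X` with no model strictly below them (`isAnswerSet_iff`).

Strong equivalence detects every model: `contextProgram Y X` leaves only `Y` and `X` as candidates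
below `X`, so whether `X` is an answer set reveals whether `Y` is a model
(`StronglyEquivalent.htSat`).

**KC** is sound for these models (`KC_sound`). For rules over `[¬]` it is also complete
(`KC_complete`): in a maximal theory not deriving `B`, weak excluded middle decides every negation,
and the derivable atoms and the doubly negated derivable atoms give `Y` and `X`.

For minimality, `caseProgram q q` yields `q` intuitionistically and has the same models as
`caseProgram p q`. Any logic respecting this derives `q` from `¬p → q` and `¬¬p → q`; substituting
`A` for `p` and `¬A ∨ ¬¬A` for `q` gives the scheme of **KC**. -/

namespace PropForm

/-! ### Here-and-there satisfaction and the reduct -/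

variable {α : Type*}

/-- Truth in the world "here" of the here-and-there model whose worlds are `Y` and `X`. -/
def HTSat (Y X : Set α) : PropForm α → Prop
  | atom p => p ∈ Y
  | bot => False
  | top => True
  | and A B => HTSat Y X A ∧ HTSat Y X B
  | or A B => HTSat Y X A ∨ HTSat Y X B
  | imp A B => (HTSat Y X A → HTSat Y X B) ∧ (Sat X A → Sat X B)
  | neg A => ¬ Sat X A

theorem HTSat.sat {Y X : Set α} (h : Y ⊆ X) {A : PropForm α} (hA : HTSat Y X A) : Sat X A := by
  induction A with
  | atom p => exact h hA
  | bot => exact hA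
  | top => trivial
  | and A B ihA ihB => exact ⟨ihA hA.1, ihB hA.2⟩
  | or A B ihA ihB => exact hA.imp ihA ihB
  | imp A B _ _ => exact hA.2
  | neg A _ => exact hA

theorem htSat_self {X : Set α} {A : PropForm α} : HTSat X X A ↔ Sat X A := by
  induction A <;> simp_all [HTSat, Sat]

theorem sat_reduct_self {X : Set α} {A : PropForm α} : Sat X (reduct X A) ↔ Sat X A := by
  induction A with
  | neg A _ => by_cases h : Sat X A <;> simp [reduct, Sat, h]
  | _ => simp_all [reduct, Sat]

theorem sat_reduct_neg {Y X : Set α} {A : PropForm α} :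
    Sat Y (reduct X A.neg) ↔ ¬ Sat X A := by
  by_cases h : Sat X A <;> simp [reduct, Sat, h]

theorem InNeg.sat_reduct {Y X : Set α} {A : PropForm α} (hA : InNeg A) :
    Sat Y (reduct X A) ↔ HTSat Y X A := by
  cases hA with
  | atom p => rfl
  | neg _ => exact sat_reduct_neg

/-- Negations are evaluated at `X` on both sides. The conjunct `Sat X R` supplies the half of an
implication that concerns `X`, which the reduct evaluated at `Y` does not record. -/
theorem htSat_iff_sat_reduct {Y X : Set α} (h : Y ⊆ X) {R : PropForm α}
    (hR : R ∈ negRules α ∪ negFragment α) : HTSat Y X R ↔ Sat Y (reduct X R) ∧ Sat X R := by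
  rcases hR with ⟨A, hA, B, hB, rfl⟩ | hR
  · exact (and_congr (imp_congr hA.sat_reduct hB.sat_reduct) Iff.rfl).symm
  · rw [InNeg.sat_reduct hR]
    exact ⟨fun h' => ⟨h', h'.sat h⟩, And.left⟩

theorem subst_subst (τ σ : α → PropForm α) (A : PropForm α) :
    subst τ (subst σ A) = subst (fun a => subst τ (σ a)) A := by
  induction A <;> simp_all [subst]

end PropForm

open PropForm

/-! ### The Hilbert calculus and maximal theories -/

namespace Derives

variable {α : Type*} {Ax T : Set (PropForm α)} {A B C : PropForm α}

/-- Induction on derivations that treats the intuitionistic axioms uniformly. -/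
theorem induction_axioms {motive : PropForm α → Prop} (hyp : ∀ A ∈ T, motive A)
    (scheme : ∀ (σ : α → PropForm α), ∀ A ∈ Ax, motive (subst σ A))
    (mp : ∀ A B, motive (imp A B) → motive A → motive B)
    (ax : ∀ A, (∀ Ax T : Set (PropForm α), Derives Ax T A) →
      (∀ (Ax T : Set (PropForm α)) (τ : α → PropForm α), Derives Ax T (subst τ A)) → motive A)
    (h : Derives Ax T A) : motive A := by
  induction h with
  | hyp h => exact hyp _ h
  | scheme σ h => exact scheme σ _ h
  | mp _ _ ih₁ ih₂ => exact mp _ _ ih₁ ih₂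
  | axK => exact ax _ (fun _ _ => .axK _ _) fun _ _ _ => .axK _ _
  | axS => exact ax _ (fun _ _ => .axS _ _ _) fun _ _ _ => .axS _ _ _
  | andIntro => exact ax _ (fun _ _ => .andIntro _ _) fun _ _ _ => .andIntro _ _
  | andLeft => exact ax _ (fun _ _ => .andLeft _ _) fun _ _ _ => .andLeft _ _
  | andRight => exact ax _ (fun _ _ => .andRight _ _) fun _ _ _ => .andRight _ _
  | orLeft => exact ax _ (fun _ _ => .orLeft _ _) fun _ _ _ => .orLeft _ _
  | orRight => exact ax _ (fun _ _ => .orRight _ _) fun _ _ _ => .orRight _ _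
  | orElim => exact ax _ (fun _ _ => .orElim _ _ _) fun _ _ _ => .orElim _ _ _
  | botElim => exact ax _ (fun _ _ => .botElim _) fun _ _ _ => .botElim _
  | topIntro => exact ax _ (fun _ _ => .topIntro) fun _ _ _ => .topIntro
  | negIntro => exact ax _ (fun _ _ => .negIntro _) fun _ _ _ => .negIntro _
  | negElim => exact ax _ (fun _ _ => .negElim _) fun _ _ _ => .negElim _

/-- Derivations can be replayed where the hypotheses and the scheme instances are derivable. -/
theorem translate {Ax' T' : Set (PropForm α)} (hT : ∀ B ∈ T, Derives Ax' T' B)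
    (hAx : ∀ σ, ∀ B ∈ Ax, Derives Ax' T' (subst σ B)) (h : Derives Ax T A) : Derives Ax' T' A :=
  h.induction_axioms hT hAx (fun _ _ => mp) fun _ hA _ => hA _ _

theorem mono {T' : Set (PropForm α)} (hT : T ⊆ T') (h : Derives Ax T A) : Derives Ax T' A :=
  h.translate (fun _ hB => hyp (hT hB)) fun σ _ hB => scheme σ hB

theorem weaken (h : Derives Ax T B) : Derives Ax T (imp A B) := mp (axK _ _) h

theorem imp_self : Derives Ax T (imp A A) := mp (mp (axS A (imp A A) A) (axK _ _)) (axK _ _)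

/-- The deduction theorem. -/
theorem intro (h : Derives Ax (insert A T) B) : Derives Ax T (imp A B) := by
  refine h.induction_axioms (motive := fun B => Derives Ax T (imp A B)) ?_
    (fun σ _ hB => (scheme σ hB).weaken) (fun _ _ h₁ h₂ => mp (mp (axS _ _ _) h₁) h₂)
    fun _ hB _ => (hB _ _).weaken
  rintro B (rfl | hB)
  · exact imp_self
  · exact (hyp hB).weaken

theorem weaken_insert (h : Derives Ax T A) : Derives Ax (insert B T) A :=
  h.mono (Set.subset_insert _ _)

theorem head : Derives Ax (insert A T) A := hyp (Set.mem_insert _ _)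

theorem absurd (h : Derives Ax T A) (h' : Derives Ax T A.neg) : Derives Ax T B :=
  mp (botElim _) (mp (mp (negElim _) h') h)

theorem neg_of_imp_bot (h : Derives Ax T (imp A bot)) : Derives Ax T A.neg := mp (negIntro _) h

theorem contrapose (h : Derives Ax T (imp A B)) : Derives Ax T (imp B.neg A.neg) :=
  intro (neg_of_imp_bot (intro
    (absurd (mp h.weaken_insert.weaken_insert head) head.weaken_insert)))

theorem not_not (h : Derives Ax T A) : Derives Ax T A.neg.neg :=
  neg_of_imp_bot (intro (absurd h.weaken_insert head))

theorem of_or (h : Derives Ax T (or A B)) (hA : Derives Ax T (imp A C))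
    (hB : Derives Ax T (imp B C)) : Derives Ax T C :=
  mp (mp (mp (orElim _ _ _) hA) hB) h

theorem subst_empty (τ : α → PropForm α) (h : Derives Ax ∅ A) :
    Derives Ax ∅ (subst τ A) :=
  h.induction_axioms (motive := fun A => Derives Ax ∅ (subst τ A)) (fun _ hB => hB.elim)
    (fun _ _ hB => by rw [subst_subst]; exact scheme _ hB) (fun _ _ => mp) fun _ _ hB => hB _ _ τ

/-- Compactness: a derivation uses finitely many hypotheses, so one member of the chain contains
them all. This feeds Zorn's lemma. -/
theorem of_sUnion {c : Set (Set (PropForm α))} (hc : IsChain (· ⊆ ·) c) (hne : c.Nonempty)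
    (h : Derives Ax (⋃₀ c) A) : ∃ Γ ∈ c, Derives Ax Γ A := by
  refine h.induction_axioms (motive := fun A => ∃ Γ ∈ c, Derives Ax Γ A) ?_
    (fun σ _ hB => hne.imp fun Γ hΓ => ⟨hΓ, scheme σ hB⟩) ?_
    fun _ hB _ => hne.imp fun Γ hΓ => ⟨hΓ, hB _ _⟩
  · rintro B ⟨Γ, hΓ, hB⟩
    exact ⟨Γ, hΓ, hyp hB⟩
  · rintro B C ⟨Γ, hΓ, h₁⟩ ⟨Δ, hΔ, h₂⟩
    rcases hc.total hΓ hΔ with h | h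
    · exact ⟨Δ, hΔ, mp (h₁.mono h) h₂⟩
    · exact ⟨Γ, hΓ, mp h₁ (h₂.mono h)⟩

/-- A theory that does not derive `B` extends to a maximal one. -/
theorem exists_maximal (h : ¬ Derives Ax T B) :
    ∃ Γ, T ⊆ Γ ∧ ¬ Derives Ax Γ B ∧ ∀ C, ¬ Derives Ax Γ C → Derives Ax Γ (imp C B) := by
  obtain ⟨Γ, hT, hΓ⟩ := zorn_subset_nonempty {Γ | ¬ Derives Ax Γ B}
    (fun c hc hchain hne => ⟨⋃₀ c, fun hd => by
      obtain ⟨Γ, hΓ, hd⟩ := of_sUnion hchain hne hd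
      exact hc hΓ hd, fun s hs => Set.subset_sUnion_of_mem hs⟩) T h
  refine ⟨Γ, hT, hΓ.prop, fun C hC => intro ?_⟩
  by_contra hB
  exact hC (hyp (hΓ.le_of_ge hB (Set.subset_insert _ _) (Set.mem_insert _ _)))

end Derives

/-! ### Soundness and completeness of **KC** -/

namespace IntermediateLogic

variable {α : Type*}

theorem KC_proves_em (T : Set (PropForm α)) (A : PropForm α) :
    (KC α).Proves T (A.neg.or A.neg.neg) := by
  have h : Derives (KC α).schemes T (subst atom (A.neg.or A.neg.neg)) := .scheme _ ⟨A, rfl⟩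
  have hs : ∀ B : PropForm α, subst atom B = B := fun B => by
    induction B <;> simp_all [subst]
  rwa [hs] at h

/-- Negation is evaluated classically at the single top world `X`, whence the scheme; axioms such as
`A → (B → A)` need persistence from `Y` to `X`. -/
theorem KC_sound {T : Set (PropForm α)} {A : PropForm α} (h : (KC α).Proves T A)
    {Y X : Set α} (hYX : Y ⊆ X) (hT : ∀ R ∈ T, HTSat Y X R) : HTSat Y X A := by
  have per : ∀ B : PropForm α, HTSat Y X B → Sat X B := fun B => HTSat.sat hYX
  unfold Proves at h
  induction h with
  | hyp h => exact hT _ h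
  | scheme σ h =>
    obtain ⟨B, rfl⟩ := h
    exact em (¬ Sat X (subst σ B))
  | mp _ _ ih₁ ih₂ => exact ih₁.1 ih₂
  | axK A B => have := per A; simp only [HTSat, Sat]; tauto
  | topIntro => trivial
  | axS A B C => simp only [HTSat, Sat]; tauto
  | andIntro A B => have := per A; simp only [HTSat, Sat]; tauto
  | orElim A B C => simp only [HTSat, Sat]; tauto
  | negIntro A => simp only [HTSat, Sat]; tauto
  | negElim A => have := per A; simp only [HTSat, Sat]; tauto
  | _ => simp only [HTSat, Sat]; tauto

/-- Completeness of **KC** for here-and-there models, for conclusions in `[¬]`. -/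
theorem exists_htModel_of_not_proves {T : Set (PropForm α)} {B : PropForm α} (hB : InNeg B)
    (h : ¬ (KC α).Proves T B) : ∃ Y X : Set α, Y ⊆ X ∧
      (∀ R ∈ T ∩ (negRules α ∪ negFragment α), HTSat Y X R) ∧ ¬ HTSat Y X B := by
  obtain ⟨Γ, hT, hΓ, hmax⟩ := Derives.exists_maximal h
  -- If neither were derivable, maximality would make both imply `B`, and the scheme would then give
  -- `B`. This is the only primeness needed, since the rules contain no disjunction.
  have hem : ∀ C : PropForm α, Derives (KC α).schemes Γ C.neg ∨
      Derives (KC α).schemes Γ C.neg.neg := fun C => by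
    by_contra! hC
    exact hΓ (Derives.of_or (KC_proves_em Γ C) (hmax _ hC.1) (hmax _ hC.2))
  have hcon : ∀ C : PropForm α, Derives (KC α).schemes Γ C →
      ¬ Derives (KC α).schemes Γ C.neg := fun C h₁ h₂ => hΓ (h₁.absurd h₂)
  set X : Set α := {p | Derives (KC α).schemes Γ (atom p).neg.neg}
  set Y : Set α := {p | Derives (KC α).schemes Γ (atom p)}
  have hX : ∀ C : PropForm α, InNeg C → (Sat X C ↔ Derives (KC α).schemes Γ C.neg.neg) := by
    intro C hC
    induction hC with
    | atom p => rfl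
    | neg _ ih =>
      exact (not_congr ih).trans
        ⟨fun hn => ((hem _).resolve_right hn).not_not, fun h₁ h₂ => hcon _ h₂ h₁⟩
  have hY : ∀ C : PropForm α, InNeg C → (HTSat Y X C ↔ Derives (KC α).schemes Γ C) := by
    intro C hC
    cases hC with
    | atom p => rfl
    | neg hC =>
      exact (not_congr (hX _ hC)).trans
        ⟨fun hn => (hem _).resolve_right hn, fun h₁ h₂ => hcon _ h₁ h₂⟩
  refine ⟨Y, X, fun p hp => Derives.not_not hp, ?_, fun h => hΓ ((hY B hB).1 h)⟩
  rintro R ⟨hRT, ⟨C, hC, D, hD, rfl⟩ | hR⟩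
  · have hCD : Derives (KC α).schemes Γ (imp C D) := .hyp (hT hRT)
    -- Truth at `X` is derivability of the double negation, so the classical half comes from
    -- contraposing `C → D` twice.
    exact ⟨fun h => (hY D hD).2 (hCD.mp ((hY C hC).1 h)),
      fun h => (hX D hD).2 (hCD.contrapose.contrapose.mp ((hX C hC).1 h))⟩
  · exact (hY R hR).2 (.hyp (hT hRT))

theorem KC_complete {T : Set (PropForm α)} (hT : T ⊆ negRules α ∪ negFragment α)
    {R : PropForm α} (hR : R ∈ negRules α ∪ negFragment α)
    (h : ∀ Y X : Set α, Y ⊆ X → (∀ S ∈ T, HTSat Y X S) → HTSat Y X R) :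
    (KC α).Proves T R := by
  by_contra hn
  rcases hR with ⟨A, hA, B, hB, rfl⟩ | hR
  -- By the deduction theorem, the rule is refuted by a model of `A` and `T` whose lower world fails
  -- `B`.
  · obtain ⟨Y, X, hYX, hm, hY⟩ := exists_htModel_of_not_proves (T := insert A T) hB
      fun hd => hn (Derives.intro hd)
    exact hY ((h Y X hYX fun S hS => hm S ⟨Or.inr hS, hT hS⟩).1
      (hm A ⟨Or.inl rfl, Or.inr hA⟩))
  · obtain ⟨Y, X, hYX, hm, hY⟩ := exists_htModel_of_not_proves hR hn
    exact hY (h Y X hYX fun S hS => hm S ⟨hS, hT hS⟩)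

end IntermediateLogic

/-! ### Answer sets and separating contexts -/

section AnswerSets

variable {α : Type*}

theorem isAnswerSet_iff {P : Set (PropForm α)} (hP : P ⊆ negRules α ∪ negFragment α)
    {X : Set α} : IsAnswerSet P X ↔ ∀ Y ⊆ X, ((∀ R ∈ P, HTSat Y X R) ↔ Y = X) := by
  constructor
  · intro h Y hY
    refine ⟨fun hR => (h Y hY).1 fun R hRP => ((htSat_iff_sat_reduct hY (hP hRP)).1 (hR R hRP)).1,
      ?_⟩
    rintro rfl R hRP
    exact htSat_self.2 (sat_reduct_self.1 ((h Y hY).2 rfl R hRP))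
  · intro h Y hY
    have hX := (h X subset_rfl).2 rfl
    refine ⟨fun hR => (h Y hY).1 fun R hRP => (htSat_iff_sat_reduct hY (hP hRP)).2
      ⟨hR R hRP, htSat_self.1 (hX R hRP)⟩, ?_⟩
    rintro rfl R hRP
    exact sat_reduct_self.2 (htSat_self.1 (hX R hRP))

theorem stronglyEquivalent_of_htModels {L P₁ P₂ : Set (PropForm α)}
    (hL : L ⊆ negRules α ∪ negFragment α) (h₁ : P₁ ⊆ negRules α ∪ negFragment α)
    (h₂ : P₂ ⊆ negRules α ∪ negFragment α)
    (h : ∀ Y X : Set α, Y ⊆ X → ((∀ R ∈ P₁, HTSat Y X R) ↔ ∀ R ∈ P₂, HTSat Y X R)) :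
    StronglyEquivalent L P₁ P₂ := by
  intro P hP X
  rw [isAnswerSet_iff (Set.union_subset h₁ (hP.trans hL)),
    isAnswerSet_iff (Set.union_subset h₂ (hP.trans hL))]
  refine forall₂_congr fun Y hY => ?_
  simp only [Set.mem_union, or_imp, forall_and, h Y X hY]

/-- The program `{¬p → q, ¬¬p → q}`. -/
def caseProgram (p q : α) : Set (PropForm α) :=
  {((PropForm.atom p).neg).imp (.atom q), ((PropForm.atom p).neg.neg).imp (.atom q)}

theorem caseProgram_subset (p q : α) : caseProgram p q ⊆ negRules α := by
  rintro _ (rfl | rfl)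
  · exact ⟨_, (InNeg.atom p).neg, _, InNeg.atom q, rfl⟩
  · exact ⟨_, (InNeg.atom p).neg.neg, _, InNeg.atom q, rfl⟩

/-- Exactly one of `¬p`, `¬¬p` holds, decided at `X`, so one rule always fires. Thus `caseProgram p
p` can replace the fact `p`, which is not in `negRules α`. -/
theorem htModel_caseProgram {p q : α} {Y X : Set α} (h : Y ⊆ X) :
    (∀ R ∈ caseProgram p q, HTSat Y X R) ↔ q ∈ Y := by
  have := @h q
  simp only [caseProgram, Set.mem_insert_iff, Set.mem_singleton_iff, forall_eq_or_imp, forall_eq,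
    HTSat, Sat]
  tauto

/-- The program in `negRules α` that forces the atoms in `Y` and identifies those in `X \ Y`. -/
def contextProgram (Y X : Set α) : Set (PropForm α) :=
  (⋃ p ∈ Y, caseProgram p p) ∪ {R | ∃ a ∈ X \ Y, ∃ b ∈ X \ Y, R = (atom a).imp (atom b)}

theorem contextProgram_subset (Y X : Set α) : contextProgram Y X ⊆ negRules α := by
  refine Set.union_subset (Set.iUnion₂_subset fun p _ => caseProgram_subset p p) ?_
  rintro _ ⟨a, _, b, _, rfl⟩
  exact ⟨_, InNeg.atom a, _, InNeg.atom b, rfl⟩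

/-- A model `Z` contains `Y`, and a single further atom drags in all of `X \ Y`. -/
theorem htModel_contextProgram {Y X Z : Set α} (hYX : Y ⊆ X) (hZX : Z ⊆ X) :
    (∀ R ∈ contextProgram Y X, HTSat Z X R) ↔ Z = Y ∨ Z = X := by
  have hsplit : (∀ R ∈ contextProgram Y X, HTSat Z X R) ↔
      Y ⊆ Z ∧ ∀ a ∈ X \ Y, ∀ b ∈ X \ Y, a ∈ Z → b ∈ Z := by
    constructor
    · intro h
      refine ⟨fun p hp => (htModel_caseProgram hZX).1 fun R hR =>
        h R (Or.inl (Set.mem_iUnion₂.2 ⟨p, hp, hR⟩)), fun a ha b hb =>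
        (h _ (Or.inr ⟨a, ha, b, hb, rfl⟩)).1⟩
    · rintro ⟨h₁, h₂⟩ R (hR | ⟨a, ha, b, hb, rfl⟩)
      · obtain ⟨p, hp, hR⟩ := Set.mem_iUnion₂.1 hR
        exact (htModel_caseProgram hZX).2 (h₁ hp) R hR
      · exact ⟨h₂ a ha b hb, fun _ => hb.1⟩
  rw [hsplit]
  constructor
  · rintro ⟨h₁, h₂⟩
    by_cases h : Z ⊆ Y
    · exact Or.inl (h.antisymm h₁)
    · obtain ⟨a, haZ, haY⟩ := Set.not_subset.1 h
      refine Or.inr (hZX.antisymm fun b hb => ?_)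
      by_cases hbY : b ∈ Y
      · exact h₁ hbY
      · exact h₂ a ⟨hZX haZ, haY⟩ b ⟨hb, hbY⟩ haZ
  · rintro (rfl | rfl)
    · exact ⟨subset_rfl, fun a ha _ _ h => (ha.2 h).elim⟩
    · exact ⟨hYX, fun _ _ b hb _ => hb.1⟩

theorem isAnswerSet_union_contextProgram_iff {P : Set (PropForm α)}
    (hP : P ⊆ negRules α ∪ negFragment α) {Y X : Set α} (hYX : Y ⊆ X) :
    IsAnswerSet (P ∪ contextProgram Y X) X ↔
      (∀ R ∈ P, HTSat X X R) ∧ ((∀ R ∈ P, HTSat Y X R) → Y = X) := by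
  rw [isAnswerSet_iff (Set.union_subset hP
    ((contextProgram_subset Y X).trans Set.subset_union_left))]
  simp only [Set.mem_union, or_imp, forall_and]
  constructor
  · intro h
    exact ⟨((h X subset_rfl).2 rfl).1,
      fun hY => (h Y hYX).1 ⟨hY, (htModel_contextProgram hYX hYX).2 (Or.inl rfl)⟩⟩
  · rintro ⟨h₁, h₂⟩ Z hZ
    rw [htModel_contextProgram hYX hZ]
    constructor
    · rintro ⟨h, rfl | rfl⟩
      · exact h₂ h
      · rfl
    · rintro rfl
      exact ⟨h₁, Or.inr rfl⟩

theorem StronglyEquivalent.symm {L P₁ P₂ : Set (PropForm α)} (h : StronglyEquivalent L P₁ P₂) :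
    StronglyEquivalent L P₂ P₁ := fun P hP X => (h P hP X).symm

theorem StronglyEquivalent.htSat {L P₁ P₂ : Set (PropForm α)} (hL : negRules α ⊆ L)
    (h₁ : P₁ ⊆ negRules α ∪ negFragment α) (h₂ : P₂ ⊆ negRules α ∪ negFragment α)
    (h : StronglyEquivalent L P₁ P₂) {Y X : Set α} (hYX : Y ⊆ X)
    (hY : ∀ R ∈ P₁, HTSat Y X R) : ∀ R ∈ P₂, HTSat Y X R := by
  have key : ∀ Z ⊆ X, _ := fun Z hZ => by
    have := h (contextProgram Z X) ((contextProgram_subset Z X).trans hL) X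
    rwa [isAnswerSet_union_contextProgram_iff h₁ hZ,
      isAnswerSet_union_contextProgram_iff h₂ hZ] at this
  have hX₁ : ∀ R ∈ P₁, HTSat X X R := fun R hR => htSat_self.2 ((hY R hR).sat hYX)
  -- The context for `Y = X` transfers total models. After that, if `Y` were not a model of `P₂`,
  -- then `X` would be an answer set of `P₂` in the context of `Y`, hence of `P₁`, forcing `Y = X`.
  have hX₂ := ((key X subset_rfl).1 ⟨hX₁, fun _ => rfl⟩).1
  by_contra hn
  have := ((key Y hYX).2 ⟨hX₂, fun h => (hn h).elim⟩).2 hY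
  subst this
  exact hn hX₂

end AnswerSets

/-! ### Strong equivalence versus **KC**, and minimality of **KC** -/

namespace IntermediateLogic

variable {α : Type*}

theorem stronglyEquivalent_of_KC_equivalent {L P₁ P₂ : Set (PropForm α)}
    (hL : L ⊆ negRules α ∪ negFragment α) (h₁ : P₁ ⊆ negRules α ∪ negFragment α)
    (h₂ : P₂ ⊆ negRules α ∪ negFragment α) (h : (KC α).Equivalent P₁ P₂) :
    StronglyEquivalent L P₁ P₂ :=
  stronglyEquivalent_of_htModels hL h₁ h₂ fun _ _ hYX =>
    ⟨fun hm R hR => KC_sound (h.1 R hR) hYX hm, fun hm R hR => KC_sound (h.2 R hR) hYX hm⟩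

theorem stronglyEquivalent_iff_KC_equivalent {L P₁ P₂ : Set (PropForm α)}
    (hL : L ⊆ negRules α ∪ negFragment α) (hL' : negRules α ⊆ L)
    (h₁ : P₁ ⊆ negRules α ∪ negFragment α) (h₂ : P₂ ⊆ negRules α ∪ negFragment α) :
    StronglyEquivalent L P₁ P₂ ↔ (KC α).Equivalent P₁ P₂ :=
  ⟨fun h => ⟨fun _ hA => KC_complete h₁ (h₂ hA) fun _ _ hYX hm => h.htSat hL' h₁ h₂ hYX hm _ hA,
    fun _ hA => KC_complete h₂ (h₁ hA) fun _ _ hYX hm => h.symm.htSat hL' h₂ h₁ hYX hm _ hA⟩,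
    stronglyEquivalent_of_KC_equivalent hL h₁ h₂⟩

theorem Proves.of_le {Λ₁ Λ₂ : IntermediateLogic α} (h : Λ₁ ≤ Λ₂) {T : Set (PropForm α)}
    {A : PropForm α} (hA : Λ₁.Proves T A) : Λ₂.Proves T A :=
  Derives.translate (fun _ hB => .hyp hB)
    (fun σ _ hB => Derives.mono (Set.empty_subset T) (h _ (.scheme σ hB))) hA

theorem KC_le_of_proves_em {Λ : IntermediateLogic α}
    (h : ∀ A : PropForm α, Λ.Proves ∅ (A.neg.or A.neg.neg)) : KC α ≤ Λ := by
  refine fun A hA => Derives.translate (fun _ hB => hB.elim) ?_ hA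
  rintro σ _ ⟨B, rfl⟩
  exact h (subst σ B)

theorem KC_le_of_caseProgram_proves {Λ : IntermediateLogic α} {p q : α} (hpq : p ≠ q)
    (h : Λ.Proves (caseProgram p q) (atom q)) : KC α ≤ Λ := by
  classical
  refine KC_le_of_proves_em fun A => ?_
  -- Hypotheses are discharged first, because substitution is applied to theorems only.
  have h' : Derives Λ.schemes ∅ (imp ((atom p).neg.neg.imp (atom q))
      (imp ((atom p).neg.imp (atom q)) (atom q))) := by
    refine .intro (.intro (Derives.mono ?_ h))
    rintro _ (rfl | rfl) <;> simp
  -- With this value at `q ≠ p`, both premises become the two injections into the disjunction.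
  have hs := h'.subst_empty fun a => if a = p then A else A.neg.or A.neg.neg
  simp only [subst, if_true, if_neg hpq.symm] at hs
  exact (hs.mp (.orRight _ _)).mp (.orLeft _ _)

theorem KC_caseProgram_proves (p q : α) : (KC α).Proves (caseProgram p q) (atom q) :=
  (KC_proves_em _ (atom p)).of_or (.hyp (Or.inl rfl)) (.hyp (Or.inr rfl))

theorem proves_of_mem_caseProgram {Λ : IntermediateLogic α} {T : Set (PropForm α)} {p q : α}
    (h : Λ.Proves T (atom q)) {R : PropForm α} (hR : R ∈ caseProgram p q) : Λ.Proves T R := by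
  rcases hR with rfl | rfl <;> exact Derives.weaken h

/-- Intuitionistically, `¬q → q` already refutes `¬q`, and then `¬¬q → q` gives `q`. -/
theorem caseProgram_self_proves (Λ : IntermediateLogic α) (q : α) :
    Λ.Proves (caseProgram q q) (atom q) := by
  have h₁ : Derives Λ.schemes (caseProgram q q) ((atom q).neg.imp (atom q)) := .hyp (Or.inl rfl)
  have h₂ : Derives Λ.schemes (caseProgram q q) ((atom q).neg.neg.imp (atom q)) :=
    .hyp (Or.inr rfl)
  exact h₂.mp (.neg_of_imp_bot (.intro (.absurd (h₁.weaken_insert.mp .head) .head)))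

theorem KC_equivalent_caseProgram (p q : α) :
    (KC α).Equivalent {atom q} (caseProgram p q) :=
  ⟨fun _ hR => proves_of_mem_caseProgram (.hyp (Set.mem_singleton _)) hR, by
    rintro _ rfl
    exact KC_caseProgram_proves p q⟩

theorem equivalent_caseProgram_iff {Λ : IntermediateLogic α} {p q : α} (hpq : p ≠ q) :
    Λ.Equivalent {atom q} (caseProgram p q) ↔ KC α ≤ Λ :=
  ⟨fun h => KC_le_of_caseProgram_proves hpq (h.2 _ rfl), fun h =>
    ⟨fun _ hR => ((KC_equivalent_caseProgram p q).1 _ hR).of_le h,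
      fun _ hR => ((KC_equivalent_caseProgram p q).2 _ hR).of_le h⟩⟩

theorem Proves.cut {Λ : IntermediateLogic α} {T T' : Set (PropForm α)} {A : PropForm α}
    (hT : ∀ B ∈ T, Λ.Proves T' B) (h : Λ.Proves T A) : Λ.Proves T' A :=
  Derives.translate hT (fun σ _ hB => .scheme σ hB) h

theorem KC_le_of_stronglyEquivalent_imp [Nontrivial α] {L : Set (PropForm α)}
    (hL : L ⊆ negRules α ∪ negFragment α) (hL' : negRules α ⊆ L) {Λ : IntermediateLogic α}
    (h : ∀ P₁ P₂ : Set (PropForm α), P₁ ⊆ L → P₂ ⊆ L →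
      StronglyEquivalent L P₁ P₂ → Λ.Equivalent P₁ P₂) : KC α ≤ Λ := by
  obtain ⟨p, q, hpq⟩ := exists_pair_ne α
  have hsub : ∀ a : α, caseProgram a q ⊆ L := fun a => (caseProgram_subset a q).trans hL'
  -- `caseProgram q q` stands in for `{q}`, since the fact `q` need not belong to `L`.
  have he := h (caseProgram q q) (caseProgram p q) (hsub q) (hsub p)
    (stronglyEquivalent_of_htModels hL ((hsub q).trans hL) ((hsub p).trans hL) fun _ _ hYX =>
      (htModel_caseProgram hYX).trans (htModel_caseProgram hYX).symm)
  exact KC_le_of_caseProgram_proves hpq ((caseProgram_self_proves Λ q).cut he.2)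

end IntermediateLogic

/-- `L` is the language of implications between formulas of `[¬]`; it is treated both literally and
with formulas of `[¬]` themselves (facts such as `q`) also allowed as rules. -/
theorem mainTheorem4 {α : Type*} (L : Set (PropForm α))
    (hL : L = negRules α ∨ L = negRules α ∪ negFragment α) :
    -- strong equivalence in `L` is equivalence in **KC**
    (∀ P₁ P₂ : Set (PropForm α), P₁ ⊆ L → P₂ ⊆ L →
      (StronglyEquivalent L P₁ P₂ ↔ (IntermediateLogic.KC α).Equivalent P₁ P₂)) ∧
    -- **KC** is the weakest logic whose equivalence is strong equivalence,
    -- and already the weakest one whose equivalence is implied by strong equivalence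
    (Nontrivial α →
      IsLeast {Λ : IntermediateLogic α | ∀ P₁ P₂ : Set (PropForm α), P₁ ⊆ L → P₂ ⊆ L →
        (StronglyEquivalent L P₁ P₂ ↔ Λ.Equivalent P₁ P₂)} (IntermediateLogic.KC α) ∧
      IsLeast {Λ : IntermediateLogic α | ∀ P₁ P₂ : Set (PropForm α), P₁ ⊆ L → P₂ ⊆ L →
        (StronglyEquivalent L P₁ P₂ → Λ.Equivalent P₁ P₂)} (IntermediateLogic.KC α)) ∧
    -- the programs `{q}` and `{¬p → q, ¬¬p → q}`
    (∀ p q : α,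
      StronglyEquivalent L {.atom q}
        {((PropForm.atom p).neg).imp (.atom q), ((PropForm.atom p).neg.neg).imp (.atom q)} ∧
      (p ≠ q → ∀ Λ : IntermediateLogic α,
        Λ.Equivalent {.atom q}
            {((PropForm.atom p).neg).imp (.atom q), ((PropForm.atom p).neg.neg).imp (.atom q)} ↔
          IntermediateLogic.KC α ≤ Λ)) := by
  have hsub : L ⊆ negRules α ∪ negFragment α := by
    rcases hL with rfl | rfl
    · exact Set.subset_union_left
    · exact subset_rfl
  have hsup : negRules α ⊆ L := by
    rcases hL with rfl | rfl
    · exact subset_rfl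
    · exact Set.subset_union_left
  have key : ∀ P₁ P₂ : Set (PropForm α), P₁ ⊆ L → P₂ ⊆ L →
      (StronglyEquivalent L P₁ P₂ ↔ (IntermediateLogic.KC α).Equivalent P₁ P₂) :=
    fun P₁ P₂ h₁ h₂ => IntermediateLogic.stronglyEquivalent_iff_KC_equivalent hsub hsup
      (h₁.trans hsub) (h₂.trans hsub)
  refine ⟨key, fun _ => ⟨⟨key, fun Λ hΛ => ?_⟩, ⟨fun P₁ P₂ h₁ h₂ => (key P₁ P₂ h₁ h₂).1,
    fun Λ hΛ => IntermediateLogic.KC_le_of_stronglyEquivalent_imp hsub hsup hΛ⟩⟩,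
    fun p q => ⟨?_, fun hpq Λ => IntermediateLogic.equivalent_caseProgram_iff hpq⟩⟩
  · exact IntermediateLogic.KC_le_of_stronglyEquivalent_imp hsub hsup
      fun P₁ P₂ h₁ h₂ => (hΛ P₁ P₂ h₁ h₂).1
  · refine IntermediateLogic.stronglyEquivalent_of_KC_equivalent hsub ?_
      ((caseProgram_subset p q).trans Set.subset_union_left)
      (IntermediateLogic.KC_equivalent_caseProgram p q)
    rintro _ rfl
    exact Or.inr (InNeg.atom q)
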